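/- A matrix $T\in\mathbb{C}^{n\times n}$ is called Toeplitz if $T_{i,j}=T_{i+1,j+1}$ for all $1\le i,j\le n-1$. For $M\in\mathbb{C}^{n\times n}$, let $\mathrm{Toep}(M)$ denote the smallest integer $s\ge 1$ such that $M=T_1T_2\cdots T_s$ for some Toeplitz matrices $T_1,\dots,T_s\in\mathbb{C}^{n\times n}$ (and $\mathrm{Toep}(M)=\infty$ if there is no such $s$), and let $\mathrm{Toep}_n=\sup_{M\in\mathbb{C}^{n\times n}}\mathrm{Toep}(M)\in\mathbb{N}\cup\{\infty\}$ be the maximal Toeplitz number of order $n$. Then $$3\le \mathrm{Toep}_4\le 9.$$ In particular, $\mathrm{Toep}_4$ is finite and the supremum is a maximum. -/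

import Mathlib

/-- A square complex matrix is Toeplitz if `M i j = M (i+1) (j+1)` whenever both entries exist,
that is, if it is constant along each descending diagonal. -/
def IsToeplitz {n : ℕ} (M : Matrix (Fin n) (Fin n) ℂ) : Prop :=
  ∀ i j i' j' : Fin n, (i' : ℕ) = i + 1 → (j' : ℕ) = j + 1 → M i j = M i' j'

/-- `M` has a Toeplitz decomposition of length `s`: it is an ordered product `T₁ T₂ ⋯ Tₛ` of
`s ≥ 1` Toeplitz matrices. -/
def HasToeplitzDecomposition {n : ℕ} (M : Matrix (Fin n) (Fin n) ℂ) (s : ℕ) : Prop :=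
  1 ≤ s ∧ ∃ T : List (Matrix (Fin n) (Fin n) ℂ),
    T.length = s ∧ (∀ A ∈ T, IsToeplitz A) ∧ T.prod = M

/-- The Toeplitz number of `M`: the minimal length of a Toeplitz decomposition of `M`
(`⊤` if there were none). -/
noncomputable def toeplitzNumber {n : ℕ} (M : Matrix (Fin n) (Fin n) ℂ) : ℕ∞ :=
  ⨅ (s : ℕ) (_ : HasToeplitzDecomposition M s), (s : ℕ∞)

/-- The maximal Toeplitz number of order `n`: the largest Toeplitz number of an `n × n` complex
matrix. Values are in `ℕ∞`, where a finite supremum is attained, hence a maximum. -/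
noncomputable def maxToeplitzNumber (n : ℕ) : ℕ∞ :=
  ⨆ M : Matrix (Fin n) (Fin n) ℂ, toeplitzNumber M

/-! Upper bound: the product map from triples of Toeplitz matrices (21 parameters) to 4 × 4 matrices
has surjective differential at an explicit point, hence its image contains an open set and the map
is dominant. By Chevalley and the Nullstellensatz, every matrix off some proper hypersurface is a
product of three Toeplitz matrices. An invertible `M` is `A * (A⁻¹ * M)` with both factors generic,
so six suffice. If `M` is singular, some product `D` of three Toeplitz matrices has the same column
space, so `M = D * A` with `A` invertible: 3 + 6 = 9. Lower bound: subtracting from a product of two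
Toeplitz matrices its shift along the diagonal leaves rank at most two, whereas `diag(0, 1, 2, 3)`
leaves the 3 × 3 identity. -/

open MvPolynomial in
/-- A dominant polynomial map over an algebraically closed field hits every point outside a
proper hypersurface. -/
theorem exists_ne_zero_forall_exists_eval_eq {K σ τ : Type*} [Field K] [IsAlgClosed K]
    [Finite σ] [Finite τ] (φ : MvPolynomial σ K →ₐ[K] MvPolynomial τ K)
    (hφ : Function.Injective φ) :
    ∃ f : MvPolynomial σ K, f ≠ 0 ∧ ∀ x : σ → K, eval x f ≠ 0 →
      ∃ y : τ → K, ∀ i, eval y (φ (X i)) = x i := by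
  have hfp : (φ : MvPolynomial σ K →+* MvPolynomial τ K).FinitePresentation := by
    apply RingHom.FinitePresentation.of_finiteType.mp
    refine RingHom.FiniteType.of_comp_finiteType (f := algebraMap K (MvPolynomial σ K)) ?_
    have : (φ : MvPolynomial σ K →+* MvPolynomial τ K).comp (algebraMap K (MvPolynomial σ K))
      = algebraMap K (MvPolynomial τ K) := φ.comp_algebraMap
    rw [this]
    rw [RingHom.finiteType_algebraMap]
    infer_instance
  -- Chevalley: the image on spectra is constructible. Injectivity puts the generic point in it, so
  -- the piece containing that point has no closed conditions and is the basic open set of `B.f`.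
  obtain ⟨S, hS⟩ := PrimeSpectrum.exists_constructibleSetData_iff.mpr
    (PrimeSpectrum.isConstructible_range_comap hfp)
  have hbot : (⊥ : PrimeSpectrum (MvPolynomial σ K)) ∈ S.toSet := by
    rw [hS]
    refine ⟨⊥, ?_⟩
    ext1
    exact (RingHom.injective_iff_ker_eq_bot _).mp hφ
  simp only [PrimeSpectrum.ConstructibleSetData.toSet, Set.mem_iUnion] at hbot
  obtain ⟨B, hBS, hB, hB'⟩ := hbot
  have hg : ∀ i, B.g i = 0 := fun i ↦ by
    have := hB ⟨i, rfl⟩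
    simpa using this
  have hf : B.f ≠ 0 := fun h ↦ hB' (by simp [h])
  refine ⟨B.f, hf, fun x hx ↦ ?_⟩
  let m : PrimeSpectrum (MvPolynomial σ K) := ⟨RingHom.ker (eval x), RingHom.ker_isPrime _⟩
  have hm : m ∈ Set.range (PrimeSpectrum.comap (φ : MvPolynomial σ K →+* MvPolynomial τ K)) := by
    rw [← hS]
    simp only [PrimeSpectrum.ConstructibleSetData.toSet, Set.mem_iUnion]
    refine ⟨B, hBS, ?_, ?_⟩
    · rintro _ ⟨i, rfl⟩
      rw [hg i]
      exact Ideal.zero_mem _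
    · simpa [m, RingHom.mem_ker] using hx
  obtain ⟨q, hq⟩ := hm
  -- A maximal ideal above the preimage `q` is a point `y` by the Nullstellensatz; it still contains
  -- the images of all `X i - C (x i)`.
  obtain ⟨n, hn, hqn⟩ := Ideal.exists_le_maximal q.asIdeal q.2.ne_top
  obtain ⟨y, rfl⟩ := (isMaximal_iff_eq_vanishingIdeal_singleton (K := K)).mp hn
  refine ⟨y, fun i ↦ ?_⟩
  have h1 : (X i - C (x i) : MvPolynomial σ K) ∈ m.asIdeal := by simp [m, RingHom.mem_ker]
  rw [← hq] at h1
  have h2 := hqn h1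
  rw [mem_vanishingIdeal_singleton_iff] at h2
  simpa [sub_eq_zero, ← algebraMap_eq] using h2

/-- Complements of the two kernels are both isomorphic to the common range; the kernels have equal
dimension by rank-nullity, and the two isomorphisms glue. -/
theorem LinearMap.exists_linearEquiv_comp_eq_of_range_eq {K V W : Type*} [Field K]
    [AddCommGroup V] [Module K V] [FiniteDimensional K V] [AddCommGroup W] [Module K W]
    {f g : V →ₗ[K] W} (h : LinearMap.range f = LinearMap.range g) :
    ∃ e : V ≃ₗ[K] V, f = g ∘ₗ e := by
  obtain ⟨C, hC⟩ := (LinearMap.ker f).exists_isCompl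
  obtain ⟨C', hC'⟩ := (LinearMap.ker g).exists_isCompl
  let r : C ≃ₗ[K] C' := (f.kerComplementEquivRange hC.symm).trans
    ((LinearEquiv.ofEq _ _ h).trans (g.kerComplementEquivRange hC'.symm).symm)
  have hr : ∀ c, g (r c) = f c := fun c ↦ by
    have := (g.kerComplementEquivRange hC'.symm).apply_symm_apply
      (LinearEquiv.ofEq _ _ h (f.kerComplementEquivRange hC.symm c))
    exact congrArg Subtype.val this
  have hk : Module.finrank K (LinearMap.ker f) = Module.finrank K (LinearMap.ker g) := by
    have h1 := f.finrank_range_add_finrank_ker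
    have h2 := g.finrank_range_add_finrank_ker
    rw [h] at h1
    omega
  let k := LinearEquiv.ofFinrankEq _ _ hk
  refine ⟨(Submodule.prodEquivOfIsCompl _ _ hC).symm.trans ((k.prodCongr r).trans
    (Submodule.prodEquivOfIsCompl _ _ hC')), ?_⟩
  ext v
  obtain ⟨⟨a, b⟩, rfl⟩ := (Submodule.prodEquivOfIsCompl _ _ hC).surjective v
  simp [hr]

theorem Matrix.exists_isUnit_mul_eq_of_range_eq {n K : Type*} [Fintype n] [DecidableEq n] [Field K]
    {M D : Matrix n n K} (h : LinearMap.range M.mulVecLin = LinearMap.range D.mulVecLin) :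
    ∃ A : Matrix n n K, IsUnit A.det ∧ M = D * A := by
  obtain ⟨e, he⟩ := LinearMap.exists_linearEquiv_comp_eq_of_range_eq h
  refine ⟨LinearMap.toMatrix' e.toLinearMap, ?_, ?_⟩
  · rw [LinearMap.det_toMatrix']
    exact e.isUnit_det'
  · apply Matrix.toLin'.injective
    rw [Matrix.toLin'_mul, Matrix.toLin'_toMatrix']
    exact he

/-! ### Toeplitz matrices and decompositions -/

/-- The `4 × 4` Toeplitz matrix whose diagonals, from the upper right to the lower left corner,
carry the given seven values. -/
def toeplitz {R : Type*} (t : Fin 7 → R) : Matrix (Fin 4) (Fin 4) R :=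
  Matrix.of fun i j ↦ t ⟨i + 3 - j, by omega⟩

theorem isToeplitz_toeplitz (t : Fin 7 → ℂ) : IsToeplitz (toeplitz t) := by
  intro i j i' j' hi hj
  simp only [toeplitz, Matrix.of_apply, hi, hj]
  congr 2
  omega

theorem toeplitz_cons {R : Type*} (a b c d e f g : R) :
    toeplitz ![a, b, c, d, e, f, g] = !![d, c, b, a; e, d, c, b; f, e, d, c; g, f, e, d] := by
  ext i j
  fin_cases i <;> fin_cases j <;> rfl

theorem HasToeplitzDecomposition.of_isToeplitz {n : ℕ} {M : Matrix (Fin n) (Fin n) ℂ}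
    (h : IsToeplitz M) : HasToeplitzDecomposition M 1 :=
  ⟨le_rfl, [M], rfl, by simpa using h, by simp⟩

theorem HasToeplitzDecomposition.mul {n s t : ℕ} {M N : Matrix (Fin n) (Fin n) ℂ}
    (hM : HasToeplitzDecomposition M s) (hN : HasToeplitzDecomposition N t) :
    HasToeplitzDecomposition (M * N) (s + t) := by
  obtain ⟨hs, l, hl, hlT, rfl⟩ := hM
  obtain ⟨ht, l', hl', hlT', rfl⟩ := hN
  refine ⟨by omega, l ++ l', by simp [hl, hl'], fun A hA ↦ ?_, by simp⟩
  rcases List.mem_append.mp hA with h | h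
  exacts [hlT A h, hlT' A h]

theorem isToeplitz_one {n : ℕ} : IsToeplitz (1 : Matrix (Fin n) (Fin n) ℂ) := by
  intro i j i' j' hi hj
  simp only [Matrix.one_apply, Fin.ext_iff, hi, hj, Nat.add_right_cancel_iff]

theorem IsToeplitz.smul {n : ℕ} {M : Matrix (Fin n) (Fin n) ℂ} (h : IsToeplitz M) (c : ℂ) :
    IsToeplitz (c • M) := fun i j i' j' hi hj ↦ by
  simp [h i j i' j' hi hj]

/-- Identity factors serve as padding. -/
theorem HasToeplitzDecomposition.mono {n s t : ℕ} {M : Matrix (Fin n) (Fin n) ℂ}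
    (hM : HasToeplitzDecomposition M s) (hst : s ≤ t) : HasToeplitzDecomposition M t := by
  induction t, hst using Nat.le_induction with
  | base => exact hM
  | succ t _ ih => simpa using ih.mul (.of_isToeplitz isToeplitz_one)

theorem HasToeplitzDecomposition.smul {n s : ℕ} {M : Matrix (Fin n) (Fin n) ℂ}
    (hM : HasToeplitzDecomposition M s) (c : ℂ) : HasToeplitzDecomposition (c • M) s := by
  obtain ⟨hs, l, hl, hlT, rfl⟩ := hM
  cases l with
  | nil => simp at hl; omega
  | cons A l =>
    refine ⟨hs, (c • A) :: l, by simpa using hl, ?_, by simp⟩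
    intro B hB
    rcases List.mem_cons.mp hB with rfl | hB
    exacts [(hlT A (by simp)).smul c, hlT B (by simp [hB])]

/-! ### Generic matrices: three factors -/

/-- `toeplitz` as a linear map. -/
def toeplitzLinearMap : (Fin 7 → ℂ) →ₗ[ℂ] Matrix (Fin 4) (Fin 4) ℂ where
  toFun := toeplitz
  map_add' _ _ := rfl
  map_smul' _ _ := rfl

/-- The differential of the product of three Toeplitz matrices is onto at a suitable point. -/
theorem exists_toeplitz_mul_add_eq (M : Matrix (Fin 4) (Fin 4) ℂ) :
    ∃ x y z : Fin 7 → ℂ,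
      toeplitz x * toeplitz ![0, 0, 1, 0, 0, 1, 0]
        + toeplitz ![0, 0, 1, 0, 0, 0, -1] * toeplitz y
        + toeplitz ![0, 0, 1, 0, 0, 0, -1] * toeplitz ![0, 0, 1, 0, 0, 1, 0] * toeplitz z = M := by
  -- One solution of 16 linear equations in 21 unknowns.
  refine ⟨![M 0 1 + M 3 0, M 0 3 + M 3 2, 0, 0, 0, 0, M 0 2 + M 3 1],
    ![-M 1 2 - M 3 0 - M 3 3, M 0 0 - M 1 1 - M 3 2, M 0 2 - M 2 1, -M 1 2 + M 2 3 - M 3 0,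
      M 0 0 - M 1 1 + M 2 2, 0, -M 1 2 + M 2 0 + M 2 3],
    ![-M 0 2 + M 1 3, M 1 2 + M 3 0, -M 0 0 + M 1 1, M 2 1, M 1 2 - M 2 3,
      -M 0 3 + M 1 1 - M 2 2 - M 3 2, M 1 0 - M 2 1], ?_⟩
  simp only [toeplitz_cons]
  ext i j
  fin_cases i <;> fin_cases j <;> simp <;> ring

open Filter Topology in
/-- Products of three Toeplitz matrices contain a nonempty open set. -/
theorem exists_eventually_eq_toeplitz_mul :
    ∃ A : Matrix (Fin 4) (Fin 4) ℂ, ∀ᶠ M in 𝓝 A, ∃ x y z : Fin 7 → ℂ,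
      M = toeplitz x * toeplitz y * toeplitz z := by
  let _ : NormedRing (Matrix (Fin 4) (Fin 4) ℂ) := Matrix.linftyOpNormedRing
  let _ : NormedAlgebra ℂ (Matrix (Fin 4) (Fin 4) ℂ) := Matrix.linftyOpNormedAlgebra
  let L : (Fin 7 → ℂ) →L[ℂ] Matrix (Fin 4) (Fin 4) ℂ := toeplitzLinearMap.toContinuousLinearMap
  let E := (Fin 7 → ℂ) × (Fin 7 → ℂ) × (Fin 7 → ℂ)
  let p : E := (![0, 0, 1, 0, 0, 0, -1], ![0, 0, 1, 0, 0, 1, 0], ![0, 0, 0, 1, 0, 0, 0])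
  let L₁ : E →L[ℂ] Matrix (Fin 4) (Fin 4) ℂ := L.comp (.fst ℂ _ _)
  let L₂ : E →L[ℂ] Matrix (Fin 4) (Fin 4) ℂ :=
    L.comp ((ContinuousLinearMap.fst ℂ _ _).comp (.snd ℂ _ _))
  let L₃ : E →L[ℂ] Matrix (Fin 4) (Fin 4) ℂ :=
    L.comp ((ContinuousLinearMap.snd ℂ _ _).comp (.snd ℂ _ _))
  have h := ((L₁.hasStrictFDerivAt (x := p)).mul' (L₂.hasStrictFDerivAt (x := p))).mul'
    (L₃.hasStrictFDerivAt (x := p))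
  have hone : L₃ p = 1 := by
    change toeplitz ![0, 0, 0, 1, 0, 0, 0] = 1
    rw [toeplitz_cons]
    ext i j
    fin_cases i <;> fin_cases j <;> rfl
  have hmap := h.map_nhds_eq_of_surj (by
    rw [LinearMap.range_eq_top]
    intro M
    obtain ⟨x, y, z, rfl⟩ := exists_toeplitz_mul_add_eq M
    refine ⟨(x, y, z), ?_⟩
    change L₁ p * L₂ p * toeplitz z + (L₁ p * toeplitz y + toeplitz x * L₂ p) * L₃ p = _
    rw [hone, mul_one]
    change toeplitz ![0, 0, 1, 0, 0, 0, -1] * toeplitz ![0, 0, 1, 0, 0, 1, 0] * toeplitz z +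
      (toeplitz ![0, 0, 1, 0, 0, 0, -1] * toeplitz y +
        toeplitz x * toeplitz ![0, 0, 1, 0, 0, 1, 0]) = _
    abel)
  have hev : ∀ᶠ M in map (⇑L₁ * ⇑L₂ * ⇑L₃) (𝓝 p), ∃ x y z : Fin 7 → ℂ,
      M = toeplitz x * toeplitz y * toeplitz z :=
    eventually_map.mpr (.of_forall fun q ↦ ⟨q.1, q.2.1, q.2.2, rfl⟩)
  rw [hmap] at hev
  exact ⟨_, hev⟩

-- A neighbourhood contains a box of infinite sets, on which a nonzero polynomial cannot vanish.
open MvPolynomial Filter Topology in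
theorem MvPolynomial.eq_zero_of_eventually_eval_eq_zero {σ : Type*} [Fintype σ]
    {f : MvPolynomial σ ℂ} {a : σ → ℂ} (h : ∀ᶠ x in 𝓝 a, eval x f = 0) : f = 0 := by
  rw [nhds_pi, Filter.eventually_iff, Filter.mem_pi'] at h
  obtain ⟨I, t, ht, hI⟩ := h
  refine MvPolynomial.funext_set t (fun i ↦ ?_) fun x hx ↦ ?_
  · exact infinite_of_mem_nhds (a i) (ht i)
  · rw [map_zero]
    exact hI fun i _ ↦ hx i trivial

open MvPolynomial in
/-- Matrices off some proper hypersurface are products of three Toeplitz matrices. -/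
theorem exists_polynomial_hasToeplitzDecomposition_three :
    ∃ f : MvPolynomial (Fin 4 × Fin 4) ℂ, f ≠ 0 ∧ ∀ M : Matrix (Fin 4) (Fin 4) ℂ,
      eval (fun p ↦ M p.1 p.2) f ≠ 0 → HasToeplitzDecomposition M 3 := by
  let T (k : Fin 3) : Matrix (Fin 4) (Fin 4) (MvPolynomial (Fin 3 × Fin 7) ℂ) :=
    toeplitz fun i ↦ X (k, i)
  let φ : MvPolynomial (Fin 4 × Fin 4) ℂ →ₐ[ℂ] MvPolynomial (Fin 3 × Fin 7) ℂ :=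
    aeval fun p ↦ (T 0 * T 1 * T 2) p.1 p.2
  have hT (y : Fin 3 × Fin 7 → ℂ) (p : Fin 4 × Fin 4) : eval y ((T 0 * T 1 * T 2) p.1 p.2) =
      (toeplitz (fun i ↦ y (0, i)) * toeplitz (fun i ↦ y (1, i)) * toeplitz (fun i ↦ y (2, i)))
        p.1 p.2 := by
    simp [Matrix.mul_apply, T, toeplitz]
  have hφ (y : Fin 3 × Fin 7 → ℂ) (f : MvPolynomial (Fin 4 × Fin 4) ℂ) : eval y (φ f) =
      eval (fun p ↦ (toeplitz (fun i ↦ y (0, i)) * toeplitz (fun i ↦ y (1, i)) *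
        toeplitz (fun i ↦ y (2, i))) p.1 p.2) f := by
    simp_rw [← hT]
    change eval y (aeval _ f) = _
    exact eval₂Hom_bind₁ _ _ _ _
  have hinj : Function.Injective φ := by
    rw [injective_iff_map_eq_zero]
    intro f hf
    obtain ⟨A, hA⟩ := exists_eventually_eq_toeplitz_mul
    have hc : Continuous fun (x : Fin 4 × Fin 4 → ℂ) ↦ (Matrix.of fun i j ↦ x (i, j)) := by
      fun_prop
    refine eq_zero_of_eventually_eval_eq_zero (a := fun p ↦ A p.1 p.2) ?_
    filter_upwards [(hc.tendsto fun p ↦ A p.1 p.2).eventually hA] with x hx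
    obtain ⟨a, b, c, h⟩ := hx
    have := hφ (fun p ↦ ![a, b, c] p.1 p.2) f
    rw [hf, map_zero] at this
    simp only [Matrix.cons_val] at this
    rw [this]
    congr 2
    funext p
    exact congrFun₂ h p.1 p.2
  obtain ⟨f, hf, h⟩ := exists_ne_zero_forall_exists_eval_eq φ hinj
  refine ⟨f, hf, fun M hM ↦ ?_⟩
  obtain ⟨y, hy⟩ := h _ hM
  have : M = toeplitz (fun i ↦ y (0, i)) * toeplitz (fun i ↦ y (1, i)) *
      toeplitz (fun i ↦ y (2, i)) := by
    ext i j
    rw [← hy (i, j), hφ, eval_X]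
  rw [this]
  exact ((HasToeplitzDecomposition.of_isToeplitz (isToeplitz_toeplitz _)).mul
    (.of_isToeplitz (isToeplitz_toeplitz _))).mul (.of_isToeplitz (isToeplitz_toeplitz _))

/-! ### Invertible matrices: six factors -/

open MvPolynomial in
theorem hasToeplitzDecomposition_six_of_isUnit_det {M : Matrix (Fin 4) (Fin 4) ℂ}
    (hM : IsUnit M.det) : HasToeplitzDecomposition M 6 := by
  obtain ⟨f, hf, h⟩ := exists_polynomial_hasToeplitzDecomposition_three
  let Y := Matrix.mvPolynomialX (Fin 4) (Fin 4) ℂ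
  have hY (A : Matrix (Fin 4) (Fin 4) ℂ) : (eval fun p ↦ A p.1 p.2).mapMatrix Y = A :=
    Matrix.mvPolynomialX_mapMatrix_eval A
  have hdet : Y.det ≠ 0 := Matrix.det_mvPolynomialX_ne_zero _ _
  have hdetY (x : Fin 4 × Fin 4 → ℂ) : eval x Y.det = (Matrix.of fun i j ↦ x (i, j)).det := by
    rw [RingHom.map_det]
    exact congrArg Matrix.det (hY (Matrix.of fun i j ↦ x (i, j)))
  -- The adjugate replaces the inverse so that the second factor is polynomial in `A`; the scalar
  -- `det A` is divided out at the end.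
  let Z : Matrix (Fin 4) (Fin 4) (MvPolynomial (Fin 4 × Fin 4) ℂ) := Y.adjugate * M.map C
  let g : MvPolynomial (Fin 4 × Fin 4) ℂ := bind₁ (fun p ↦ Z p.1 p.2) f
  have hg (x : Fin 4 × Fin 4 → ℂ) : eval x g =
      eval (fun p ↦ ((Matrix.of fun i j ↦ x (i, j)).adjugate * M) p.1 p.2) f := by
    refine (eval₂Hom_bind₁ _ _ _ _).trans ?_
    change eval (fun p ↦ (eval x).mapMatrix Z p.1 p.2) f = _
    have h1 : (eval x).mapMatrix (M.map C) = M := by ext; simp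
    have h2 : (eval x).mapMatrix Y = Matrix.of fun i j ↦ x (i, j) :=
      hY (Matrix.of fun i j ↦ x (i, j))
    have h3 : (eval x).mapMatrix Z = (Matrix.of fun i j ↦ x (i, j)).adjugate * M := by
      rw [map_mul, RingHom.map_adjugate, h1, h2]
    rw [h3]
  have hg0 : g ≠ 0 := by
    obtain ⟨x, hx⟩ : ∃ x, eval x (f * Y.det) ≠ 0 := by
      by_contra! H
      exact mul_ne_zero hf hdet (MvPolynomial.funext fun x ↦ by simpa using H x)
    rw [map_mul, hdetY] at hx
    set B : Matrix (Fin 4) (Fin 4) ℂ := Matrix.of fun i j ↦ x (i, j) with hB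
    have hBdet := right_ne_zero_of_mul hx
    -- A cube root is needed because the adjugate has degree 3: with this `c`, the point `c • (M *
    -- B.adjugate)` is sent to the generic `B`, so `g` is not zero.
    obtain ⟨c, hc⟩ := IsAlgClosed.exists_pow_nat_eq (M.det * B.det ^ 2)⁻¹ (n := 3) (by norm_num)
    intro hg0
    have h1 := hg fun p ↦ (c • (M * B.adjugate)) p.1 p.2
    have h2 : (Matrix.of fun i j ↦ (c • (M * B.adjugate)) i j).adjugate * M = B := by
      change (c • (M * B.adjugate)).adjugate * M = B
      rw [Matrix.adjugate_smul, Matrix.adjugate_mul_distrib, smul_mul_assoc, mul_assoc,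
        Matrix.adjugate_mul, Matrix.adjugate_adjugate _ (by simp)]
      simp only [Fintype.card_fin, Nat.reduceSub, hc, smul_mul_assoc, Matrix.mul_smul,
        Matrix.mul_one, smul_smul]
      rw [mul_comm (B.det ^ 2), inv_mul_cancel₀ (mul_ne_zero hM.ne_zero (pow_ne_zero _ hBdet)), one_smul]
    rw [h2, hg0, map_zero] at h1
    exact left_ne_zero_of_mul hx h1.symm
  obtain ⟨x, hx⟩ : ∃ x, eval x (f * g * Y.det) ≠ 0 := by
    by_contra! H
    exact mul_ne_zero (mul_ne_zero hf hg0) hdet (MvPolynomial.funext fun x ↦ by simpa using H x)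
  rw [map_mul, map_mul, hdetY, hg] at hx
  set A : Matrix (Fin 4) (Fin 4) ℂ := Matrix.of fun i j ↦ x (i, j) with hA
  have hAdet := right_ne_zero_of_mul hx
  have h3 := (h A (left_ne_zero_of_mul (left_ne_zero_of_mul hx))).mul
    (h _ (right_ne_zero_of_mul (left_ne_zero_of_mul hx)))
  convert h3.smul A.det⁻¹ using 1
  rw [← mul_assoc, Matrix.mul_adjugate, smul_mul_assoc, one_mul, smul_smul,
    inv_mul_cancel₀ hAdet, one_smul]

/-! ### Column spaces of dimension at most three -/

/-- A subspace that is the column space of a product of three Toeplitz matrices. -/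
def IsToeplitzRange (W : Submodule ℂ (Fin 4 → ℂ)) : Prop :=
  ∃ D, HasToeplitzDecomposition D 3 ∧ LinearMap.range D.mulVecLin = W

theorem IsToeplitzRange.of_toeplitz {W : Submodule ℂ (Fin 4 → ℂ)} {r s t : Fin 7 → ℂ}
    (h : LinearMap.range (toeplitz r * toeplitz s * toeplitz t).mulVecLin = W) :
    IsToeplitzRange W :=
  ⟨_, ((HasToeplitzDecomposition.of_isToeplitz (isToeplitz_toeplitz r)).mul
    (.of_isToeplitz (isToeplitz_toeplitz s))).mul (.of_isToeplitz (isToeplitz_toeplitz t)), h⟩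

theorem Matrix.range_mulVecLin_eq_span_pair {M : Matrix (Fin 4) (Fin 4) ℂ} {f g : Fin 4 → ℂ}
    {i j : Fin 4} {a b c d : ℂ} (h0 : ∀ k, k ≠ i → k ≠ j → M.col k = 0)
    (hi : M.col i = a • f + b • g) (hj : M.col j = c • f + d • g) (hdet : a * d - b * c ≠ 0) :
    LinearMap.range M.mulVecLin = Submodule.span ℂ {f, g} := by
  rw [Matrix.range_mulVecLin]
  apply le_antisymm
  · rw [Submodule.span_le]
    rintro _ ⟨k, rfl⟩
    rw [SetLike.mem_coe, Submodule.mem_span_pair]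
    by_cases hki : k = i
    · exact ⟨a, b, by rw [hki, hi]⟩
    by_cases hkj : k = j
    · exact ⟨c, d, by rw [hkj, hj]⟩
    exact ⟨0, 0, by simp [h0 k hki hkj]⟩
  · rw [Submodule.span_le]
    have hmi : M.col i ∈ Submodule.span ℂ (Set.range M.col) := Submodule.subset_span ⟨i, rfl⟩
    have hmj : M.col j ∈ Submodule.span ℂ (Set.range M.col) := Submodule.subset_span ⟨j, rfl⟩
    rw [Set.pair_subset_iff]
    constructor
    · have := Submodule.smul_mem _ (a * d - b * c)⁻¹
        (Submodule.sub_mem _ (Submodule.smul_mem _ d hmi) (Submodule.smul_mem _ b hmj))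
      have e : (a * d - b * c)⁻¹ • (d • M.col i - b • M.col j) = f := by
        rw [hi, hj, inv_smul_eq_iff₀ hdet]
        module
      rwa [e] at this
    · have := Submodule.smul_mem _ (a * d - b * c)⁻¹
        (Submodule.sub_mem _ (Submodule.smul_mem _ a hmj) (Submodule.smul_mem _ c hmi))
      have e : (a * d - b * c)⁻¹ • (a • M.col j - c • M.col i) = g := by
        rw [hi, hj, inv_smul_eq_iff₀ hdet]
        module
      rwa [e] at this

theorem isToeplitzRange_span_singleton (v : Fin 4 → ℂ) :
    IsToeplitzRange (Submodule.span ℂ {v}) := by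
  refine .of_toeplitz (r := ![0, 0, 0, v 0, v 1, v 2, v 3]) (s := ![1, 0, 0, 0, 0, 0, 0])
    (t := ![0, 0, 0, 0, 0, 0, 1]) ?_
  have h0 : (toeplitz ![0, 0, 0, v 0, v 1, v 2, v 3] * toeplitz ![1, 0, 0, 0, 0, 0, 0] *
    toeplitz ![0, 0, 0, 0, 0, 0, 1]) = Matrix.of fun i j ↦ v i * ![1, 0, 0, 0] j := by
    simp only [toeplitz_cons]
    ext i j
    fin_cases i <;> fin_cases j <;> simp
  rw [h0, Matrix.range_mulVecLin]
  apply le_antisymm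
  · rw [Submodule.span_le]
    rintro _ ⟨j, rfl⟩
    exact Submodule.mem_span_singleton.mpr ⟨![1, 0, 0, 0] j, by ext; simp [mul_comm]⟩
  · rw [Submodule.span_le, Set.singleton_subset_iff]
    exact Submodule.subset_span ⟨0, by ext; simp⟩

theorem Submodule.span_pair_eq_of_minor_ne_zero {K ι : Type*} [Field K] {f g : ι → K} {i j : ι}
    (h : f i * g j - f j * g i ≠ 0) :
    ∃ r s : ι → K, span K {f, g} = span K {r, s} ∧ r i = 1 ∧ r j = 0 ∧ s i = 0 ∧ s j = 1 ∧
      (∀ k, f j * g k - f k * g j = 0 → r k = 0) ∧ ∀ k, f i * g k - f k * g i = 0 → s k = 0 := by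
  refine ⟨(f i * g j - f j * g i)⁻¹ • (g j • f - f j • g),
    (f i * g j - f j * g i)⁻¹ • (f i • g - g i • f), ?_, ?_, ?_, ?_, ?_, fun k hk ↦ ?_,
    fun k hk ↦ ?_⟩
  · apply le_antisymm <;> rw [Submodule.span_le, Set.pair_subset_iff] <;>
      simp only [SetLike.mem_coe, Submodule.mem_span_pair]
    · refine ⟨⟨f i, f j, ?_⟩, ⟨g i, g j, ?_⟩⟩
      · rw [smul_comm, smul_comm (f j), ← smul_add, inv_smul_eq_iff₀ h]
        module
      · rw [smul_comm, smul_comm (g j), ← smul_add, inv_smul_eq_iff₀ h]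
        module
    · refine ⟨⟨(f i * g j - f j * g i)⁻¹ * g j, -((f i * g j - f j * g i)⁻¹ * f j), by module⟩,
        ⟨-((f i * g j - f j * g i)⁻¹ * g i), (f i * g j - f j * g i)⁻¹ * f i, by module⟩⟩
  · simp only [Pi.smul_apply, Pi.sub_apply, smul_eq_mul]
    rw [inv_mul_eq_one₀ h]
    ring
  · simp only [Pi.smul_apply, Pi.sub_apply, smul_eq_mul]
    ring
  · simp only [Pi.smul_apply, Pi.sub_apply, smul_eq_mul]
    ring
  · simp only [Pi.smul_apply, Pi.sub_apply, smul_eq_mul]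
    rw [inv_mul_eq_one₀ h]
    ring
  · simp only [Pi.smul_apply, Pi.sub_apply, smul_eq_mul]
    rw [show g j * f k - f j * g k = 0 by linear_combination -hk, mul_zero]
  · simp only [Pi.smul_apply, Pi.sub_apply, smul_eq_mul]
    rw [show f i * g k - g i * f k = 0 by linear_combination hk, mul_zero]

/-- If a Toeplitz matrix maps two consecutive columns of another Toeplitz matrix to a basis of the
span of `f` and `g`, then that span is the column space of a product of three Toeplitz matrices. -/
theorem isToeplitzRange_span_pair_of_mulVec {f g : Fin 4 → ℂ} {x : Fin 7 → ℂ} {z p q r s : ℂ}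
    {a b c d : ℂ}
    (hp : (toeplitz x).mulVec ![p, q, r, s] = a • f + b • g)
    (hq : (toeplitz x).mulVec ![z, p, q, r] = c • f + d • g) (hdet : a * d - b * c ≠ 0) :
    IsToeplitzRange (Submodule.span ℂ {f, g}) := by
  -- The last factor moves columns 2 and 3 of the middle one to columns 0 and 1 and kills the rest.
  refine .of_toeplitz (r := x) (s := ![z, p, q, r, s, 0, 0]) (t := ![0, 0, 0, 0, 0, 1, 0])
    (Matrix.range_mulVecLin_eq_span_pair (i := 0) (j := 1) ?_ (hp ▸ ?_) (hq ▸ ?_) hdet)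
  · intro k h0 h1
    rw [mul_assoc]
    ext l
    fin_cases k <;> simp_all [toeplitz_cons, Matrix.mul_apply, Fin.sum_univ_four]
  · rw [mul_assoc]
    ext l
    simp [toeplitz_cons, Matrix.mul_apply, Fin.sum_univ_four, Matrix.mulVec, dotProduct]
  · rw [mul_assoc]
    ext l
    simp [toeplitz_cons, Matrix.mul_apply, Fin.sum_univ_four, Matrix.mulVec, dotProduct]

/-- The cases follow the first nonzero 2 × 2 minor; the vanishing of earlier minors gives zero
entries in the reduced basis. -/
theorem isToeplitzRange_span_pair {f g : Fin 4 → ℂ} (hfg : LinearIndependent ℂ ![f, g]) :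
    IsToeplitzRange (Submodule.span ℂ {f, g}) := by
  by_cases h01 : f 0 * g 1 - f 1 * g 0 ≠ 0
  · obtain ⟨r, s, h, h1, h2, h3, h4, -, -⟩ := Submodule.span_pair_eq_of_minor_ne_zero h01
    rw [h]
    obtain ⟨t, ht, ht'⟩ : ∃ t : ℂ, t ≠ 0 ∧ t ≠ (s 2 ^ 2 - (s 3 - r 2)) * s 2 := by
      by_cases hz : (s 2 ^ 2 - (s 3 - r 2)) * s 2 = 1
      · exact ⟨2, two_ne_zero, by rw [hz]; norm_num⟩
      · exact ⟨1, one_ne_zero, Ne.symm hz⟩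
    -- This lower triangular matrix fixes coordinates 0 and 1, where `r`, `s` form the standard
    -- basis, so the coefficients are `p, q` and `z, p`; the remaining coordinates are solved for,
    -- and `t` keeps the determinant nonzero.
    refine isToeplitzRange_span_pair_of_mulVec (x := ![0, 0, 0, 1, 0, r 2, r 3 - t])
      (z := s 2 ^ 2 - (s 3 - r 2)) (p := t) (q := s 2 * t) (r := s 2 ^ 2 * t)
      (s := t ^ 2 + s 2 * t * (s 3 - r 2))
      (a := t) (b := s 2 * t) (c := s 2 ^ 2 - (s 3 - r 2)) (d := t) ?_ ?_ ?_
    · rw [toeplitz_cons]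
      ext i
      fin_cases i <;> simp [h1, h2, h3, h4] <;> ring
    · rw [toeplitz_cons]
      ext i
      fin_cases i <;> simp [h1, h2, h3, h4] <;> ring
    · rw [show t * t - s 2 * t * (s 2 ^ 2 - (s 3 - r 2)) =
        t * (t - (s 2 ^ 2 - (s 3 - r 2)) * s 2) by ring]
      exact mul_ne_zero ht (sub_ne_zero.mpr ht')
  rw [not_not] at h01
  by_cases h02 : f 0 * g 2 - f 2 * g 0 ≠ 0
  · obtain ⟨r, s, h, h1, h2, h3, h4, hr, hs⟩ := Submodule.span_pair_eq_of_minor_ne_zero h02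
    have h5 := hs 1 h01
    rw [h]
    refine isToeplitzRange_span_pair_of_mulVec (x := ![0, 0, 0, 1, r 1, 0, r 3 - 1])
      (z := 1) (p := 0) (q := 0) (r := 1) (s := s 3 - r 1)
      (a := 0) (b := 1) (c := 1) (d := 0) ?_ ?_ (by norm_num)
    · rw [toeplitz_cons]
      ext i
      fin_cases i <;> simp [h3, h4, h5]
    · rw [toeplitz_cons]
      ext i
      fin_cases i <;> simp [h1, h2]
  rw [not_not] at h02
  by_cases h03 : f 0 * g 3 - f 3 * g 0 ≠ 0
  · obtain ⟨r, s, h, h1, h2, h3, h4, hr, hs⟩ := Submodule.span_pair_eq_of_minor_ne_zero h03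
    have h5 := hs 1 h01
    have h6 := hs 2 h02
    rw [h]
    refine isToeplitzRange_span_pair_of_mulVec (x := ![0, 0, 0, 1, r 1, r 2, 0])
      (z := 1) (p := 0) (q := 0) (r := 0) (s := 1)
      (a := 0) (b := 1) (c := 1) (d := 0) ?_ ?_ (by norm_num)
    · rw [toeplitz_cons]
      ext i
      fin_cases i <;> simp [h3, h4, h5, h6]
    · rw [toeplitz_cons]
      ext i
      fin_cases i <;> simp [h1, h2]
  rw [not_not] at h03
  by_cases h12 : f 1 * g 2 - f 2 * g 1 ≠ 0
  · obtain ⟨r, s, h, h1, h2, h3, h4, hr, hs⟩ := Submodule.span_pair_eq_of_minor_ne_zero h12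
    have h5 := hr 0 (by linear_combination -h02)
    have h6 := hs 0 (by linear_combination -h01)
    rw [h]
    refine isToeplitzRange_span_pair_of_mulVec (x := ![0, 0, 0, 1, 0, r 3, 0])
      (z := 0) (p := 0) (q := 1) (r := s 3) (s := s 3 ^ 2)
      (a := 1) (b := s 3) (c := 0) (d := 1) ?_ ?_ (by norm_num)
    · rw [toeplitz_cons]
      ext i
      fin_cases i <;> simp [h1, h2, h3, h4, h5, h6] <;> ring
    · rw [toeplitz_cons]
      ext i
      fin_cases i <;> simp [h3, h4, h6]
  rw [not_not] at h12
  by_cases h13 : f 1 * g 3 - f 3 * g 1 ≠ 0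
  · obtain ⟨r, s, h, h1, h2, h3, h4, hr, hs⟩ := Submodule.span_pair_eq_of_minor_ne_zero h13
    have h5 := hr 0 (by linear_combination -h03)
    have h6 := hs 0 (by linear_combination -h01)
    have h7 := hs 2 h12
    rw [h]
    -- The last two factors send `e₀` to `e₃` and `e₃` to `e₁`, the down-shift killing the unwanted
    -- column; the first then corrects `e₁` to `e₁ + r 2 • e₂`.
    refine .of_toeplitz (r := ![0, 0, 0, 1, r 2, 0, 0]) (s := ![0, 0, 0, 0, 1, 0, 0])
      (t := ![1, 0, 0, 0, 0, 1, 0]) (Matrix.range_mulVecLin_eq_span_pair (i := 0) (j := 3)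
        (a := 0) (b := 1) (c := 1) (d := 0) ?_ ?_ ?_ (by norm_num))
    · intro k h0 h1
      simp only [toeplitz_cons]
      ext l
      fin_cases k <;> fin_cases l <;> simp_all
    · simp only [toeplitz_cons]
      ext l
      fin_cases l <;> simp [h3, h4, h6, h7]
    · simp only [toeplitz_cons]
      ext l
      fin_cases l <;> simp [h1, h2, h5]
  rw [not_not] at h13
  by_cases h23 : f 2 * g 3 - f 3 * g 2 ≠ 0
  · obtain ⟨r, s, h, h1, h2, h3, h4, hr, hs⟩ := Submodule.span_pair_eq_of_minor_ne_zero h23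
    have h5 := hr 0 (by linear_combination -h03)
    have h6 := hs 0 (by linear_combination -h02)
    have h7 := hr 1 (by linear_combination -h13)
    have h8 := hs 1 (by linear_combination -h12)
    rw [h]
    refine isToeplitzRange_span_pair_of_mulVec (x := ![0, 0, 0, 1, 0, 0, 0])
      (z := 0) (p := 0) (q := 0) (r := 1) (s := 0)
      (a := 1) (b := 0) (c := 0) (d := 1) ?_ ?_ (by norm_num)
    · rw [toeplitz_cons]
      ext i
      fin_cases i <;> simp [h1, h2, h5, h7]
    · rw [toeplitz_cons]
      ext i
      fin_cases i <;> simp [h3, h4, h6, h8]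
  rw [not_not] at h23
  exfalso
  have hf (k : Fin 4) : f k = 0 := by
    refine (LinearIndependent.pair_iff.mp hfg (-g k) (f k) ?_).2
    ext l
    simp only [Pi.add_apply, Pi.smul_apply, smul_eq_mul, Pi.zero_apply]
    fin_cases k <;> fin_cases l <;> grind
  exact one_ne_zero (LinearIndependent.pair_iff.mp hfg 1 0 (by ext k; simp [hf k])).1

theorem IsToeplitzRange.of_dotProduct {W : Submodule ℂ (Fin 4 → ℂ)} {w : Fin 4 → ℂ}
    (hW : ∀ x, x ∈ W ↔ w ⬝ᵥ x = 0) {r s t : Fin 7 → ℂ}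
    (h : ∀ y, w ⬝ᵥ (toeplitz r).mulVec ((toeplitz s).mulVec ((toeplitz t).mulVec y)) = 0)
    (h' : ∀ x, w ⬝ᵥ x = 0 →
      ∃ y, (toeplitz r).mulVec ((toeplitz s).mulVec ((toeplitz t).mulVec y)) = x) :
    IsToeplitzRange W := by
  refine .of_toeplitz (r := r) (s := s) (t := t) ?_
  ext x
  rw [hW]
  simp only [LinearMap.mem_range, Matrix.mulVecLin_apply, ← Matrix.mulVec_mulVec]
  constructor
  · rintro ⟨y, rfl⟩
    exact h y
  · exact h' x

theorem isToeplitzRange_of_forall_mem_iff_dotProduct_eq_zero {W : Submodule ℂ (Fin 4 → ℂ)}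
    {w : Fin 4 → ℂ} (hw : w ≠ 0) (hW : ∀ x, x ∈ W ↔ w ⬝ᵥ x = 0) : IsToeplitzRange W := by
  obtain ⟨a, b, c, d, rfl⟩ : ∃ a b c d, w = ![a, b, c, d] :=
    ⟨w 0, w 1, w 2, w 3, by ext i; fin_cases i <;> rfl⟩
  by_cases ha : a ≠ 0
  · refine .of_dotProduct (w := ![1, b / a, c / a, d / a]) (fun x ↦ ?_)
      (r := ![-(d / a) + 2 * (b / a) * (c / a) - (b / a) ^ 3, (b / a) ^ 2 - c / a, -(b / a), 1,
        0, 0, 0]) (s := ![0, 0, 0, 0, 1, 0, 0]) (t := ![0, 0, 0, 1, 0, 0, 0]) (fun y ↦ ?_)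
      fun x hx ↦ ⟨![x 1 + b / a * x 2 + c / a * x 3, x 2 + b / a * x 3, x 3, 0], ?_⟩
    · rw [hW]
      simp [dotProduct, Fin.sum_univ_four]
      field_simp
      rw [mul_zero]
    · simp [toeplitz_cons, dotProduct, Fin.sum_univ_four, Matrix.mulVec]
      ring
    · simp [dotProduct, Fin.sum_univ_four] at hx
      ext i
      fin_cases i <;> simp [toeplitz_cons, dotProduct, Fin.sum_univ_four, Matrix.mulVec]
      · linear_combination -hx
      · ring
  rw [not_not] at ha
  by_cases hd : d ≠ 0
  · refine .of_dotProduct (w := ![0, b / d, c / d, 1]) (fun x ↦ ?_)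
      (r := ![0, 0, 0, 1, -(c / d), (c / d) ^ 2 - b / d, 2 * (c / d) * (b / d) - (c / d) ^ 3])
      (s := ![0, 0, 1, 0, 0, 0, 0]) (t := ![0, 0, 0, 1, 0, 0, 0]) (fun y ↦ ?_)
      fun x hx ↦ ⟨![0, x 0, x 1 + c / d * x 0, x 2 + c / d * x 1 + b / d * x 0], ?_⟩
    · rw [hW]
      simp [dotProduct, Fin.sum_univ_four, ha]
      field_simp
      rw [mul_zero]
    · simp [toeplitz_cons, dotProduct, Fin.sum_univ_four, Matrix.mulVec]
      ring
    · simp [dotProduct, Fin.sum_univ_four] at hx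
      ext i
      fin_cases i <;> simp [toeplitz_cons, dotProduct, Fin.sum_univ_four, Matrix.mulVec]
      · ring
      · linear_combination -hx
  rw [not_not] at hd
  by_cases hb : b ≠ 0
  · refine .of_dotProduct (w := ![0, 1, c / b, 0]) (fun x ↦ ?_)
      (r := ![(-(c / b)) ^ 5 + 1, (-(c / b)) ^ 4, (-(c / b)) ^ 3, (-(c / b)) ^ 2, -(c / b), 1, 0])
      (s := ![0, 0, 0, 1, 0, 0, 0]) (t := ![0, 0, 0, 1, 0, 0, 0]) (fun y ↦ ?_)
      fun x hx ↦ ⟨![x 2 + c / b * (x 3 - (c / b) ^ 2 * (x 0 - (c / b) ^ 2 * x 2)) +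
          (c / b) ^ 3 * (x 0 - (c / b) ^ 2 * x 2),
        x 3 - (c / b) ^ 2 * (x 0 - (c / b) ^ 2 * x 2), 0, x 0 - (c / b) ^ 2 * x 2], ?_⟩
    · rw [hW]
      simp [dotProduct, Fin.sum_univ_four, ha, hd]
      field_simp
      rw [mul_zero]
    · simp [toeplitz_cons, dotProduct, Fin.sum_univ_four, Matrix.mulVec]
      ring
    · simp [dotProduct, Fin.sum_univ_four] at hx
      ext i
      fin_cases i <;> simp [toeplitz_cons, dotProduct, Fin.sum_univ_four, Matrix.mulVec]
      · ring
      · linear_combination -hx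
      · ring
  rw [not_not] at hb
  have hc : c ≠ 0 := fun hc ↦ hw (by simp [ha, hb, hc, hd])
  refine .of_dotProduct hW (r := ![0, 1, 0, 0, 0, 0, 1]) (s := ![0, 0, 0, 1, 0, 0, 0])
    (t := ![0, 0, 0, 1, 0, 0, 0]) (fun y ↦ ?_) fun x hx ↦ ⟨![x 3, 0, x 0, x 1], ?_⟩
  · simp [toeplitz_cons, dotProduct, Fin.sum_univ_four, Matrix.mulVec, ha, hb, hd]
  · have hx : x 2 = 0 := by simpa [dotProduct, Fin.sum_univ_four, ha, hb, hd, hc] using hx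
    ext i
    fin_cases i <;> simp [toeplitz_cons, dotProduct, Fin.sum_univ_four, Matrix.mulVec, hx]

theorem isToeplitzRange_of_finrank_le {W : Submodule ℂ (Fin 4 → ℂ)}
    (hW : Module.finrank ℂ W ≤ 3) : IsToeplitzRange W := by
  have hb (n : ℕ) (hn : Module.finrank ℂ W = n) :
      ∃ v : Fin n → Fin 4 → ℂ, LinearIndependent ℂ v ∧ Submodule.span ℂ (Set.range v) = W := by
    let b := Module.finBasisOfFinrankEq ℂ W hn
    refine ⟨fun i ↦ b i, b.linearIndependent.map' W.subtype W.ker_subtype, ?_⟩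
    have := congrArg (Submodule.map W.subtype) b.span_eq
    rw [Submodule.map_span, ← Set.range_comp, Submodule.map_top, Submodule.range_subtype] at this
    exact this
  interval_cases hn : Module.finrank ℂ W
  · rw [Submodule.finrank_eq_zero] at hn
    rw [hn, ← Submodule.span_zero_singleton ℂ]
    exact isToeplitzRange_span_singleton 0
  · obtain ⟨v, -, rfl⟩ := hb 1 rfl
    rw [Set.range_unique]
    exact isToeplitzRange_span_singleton _
  · obtain ⟨v, hv, rfl⟩ := hb 2 rfl
    obtain ⟨f, g, rfl⟩ : ∃ f g, v = ![f, g] := ⟨v 0, v 1, by ext i; fin_cases i <;> rfl⟩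
    rw [Matrix.range_cons_cons_empty]
    exact isToeplitzRange_span_pair hv
  · have hlt : W < ⊤ := by
      rw [lt_top_iff_ne_top]
      rintro rfl
      simp at hn
    obtain ⟨φ, hφ, hWφ⟩ := W.exists_le_ker_of_lt_top hlt
    have hker := Module.Dual.finrank_ker_add_one_of_ne_zero hφ
    have hWφ := Submodule.eq_of_le_of_finrank_eq hWφ (by simp at hker; omega)
    have hdot (x : Fin 4 → ℂ) : φ x = (fun i ↦ φ (Pi.single i 1)) ⬝ᵥ x := by
      conv_lhs => rw [pi_eq_sum_univ' x]
      simp [dotProduct, mul_comm]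
    refine isToeplitzRange_of_forall_mem_iff_dotProduct_eq_zero
      (w := fun i ↦ φ (Pi.single i 1)) (fun h ↦ hφ ?_) fun x ↦ ?_
    · ext x
      simpa using congrFun h _
    · rw [hWφ, LinearMap.mem_ker, hdot]

/-! ### Upper bound -/

theorem hasToeplitzDecomposition_nine (M : Matrix (Fin 4) (Fin 4) ℂ) :
    HasToeplitzDecomposition M 9 := by
  by_cases hM : IsUnit M.det
  · exact (hasToeplitzDecomposition_six_of_isUnit_det hM).mono (by norm_num)
  · have hr : Module.finrank ℂ (LinearMap.range M.mulVecLin) ≤ 3 := by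
      by_contra! h
      apply hM
      have htop : LinearMap.range M.mulVecLin = ⊤ := by
        apply Submodule.eq_top_of_finrank_eq
        have := Submodule.finrank_le (LinearMap.range M.mulVecLin)
        simp at this ⊢
        omega
      rw [LinearMap.range_eq_top] at htop
      exact (Matrix.isUnit_iff_isUnit_det _).mp (Matrix.mulVec_surjective_iff_isUnit.mp htop)
    obtain ⟨D, hD, hDM⟩ := isToeplitzRange_of_finrank_le hr
    obtain ⟨A, hA, rfl⟩ := Matrix.exists_isUnit_mul_eq_of_range_eq hDM.symm
    exact hD.mul (hasToeplitzDecomposition_six_of_isUnit_det hA)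

/-! ### Lower bound -/

/-- The displacement of a product of two `4 × 4` Toeplitz matrices has rank at most two. -/
theorem IsToeplitz.mul_apply_sub_mul_apply {S T : Matrix (Fin 4) (Fin 4) ℂ} (hS : IsToeplitz S)
    (hT : IsToeplitz T) (i j : Fin 3) :
    (S * T) i.succ j.succ - (S * T) i.castSucc j.castSucc =
      S i.succ 0 * T 0 j.succ - S i.castSucc 3 * T 3 j.castSucc := by
  rw [Matrix.mul_apply, Matrix.mul_apply, Fin.sum_univ_four, Fin.sum_univ_four,
    hS i.castSucc 0 i.succ 1 rfl rfl, hS i.castSucc 1 i.succ 2 rfl rfl,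
    hS i.castSucc 2 i.succ 3 rfl rfl, hT 0 j.castSucc 1 j.succ rfl rfl,
    hT 1 j.castSucc 2 j.succ rfl rfl, hT 2 j.castSucc 3 j.succ rfl rfl]
  ring

theorem not_hasToeplitzDecomposition_two :
    ¬ HasToeplitzDecomposition (Matrix.diagonal fun i : Fin 4 ↦ ((i : ℕ) : ℂ)) 2 := by
  rintro ⟨-, l, hl, hT, hM⟩
  obtain ⟨A, B, rfl⟩ := List.length_eq_two.mp hl
  have h := (hT A (by simp)).mul_apply_sub_mul_apply (hT B (by simp))
  rw [List.prod_pair] at hM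
  rw [hM] at h
  -- A difference of two rank-one 3 × 3 matrices is singular, but here it would be the identity.
  have hdet (u v w x : Fin 3 → ℂ) : (Matrix.of fun i j ↦ u i * v j - w i * x j).det = 0 := by
    rw [Matrix.det_fin_three]
    simp only [Matrix.of_apply]
    ring
  have hone : (Matrix.of fun i j : Fin 3 ↦
      A i.succ 0 * B 0 j.succ - A i.castSucc 3 * B 3 j.castSucc) = 1 := by
    ext i j
    rw [Matrix.of_apply, ← h i j]
    by_cases hij : i = j <;> simp [hij, Matrix.one_apply]
  have := hdet (fun i ↦ A i.succ 0) (fun j ↦ B 0 j.succ) (fun i ↦ A i.castSucc 3)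
    fun j ↦ B 3 j.castSucc
  rw [hone, Matrix.det_one] at this
  exact one_ne_zero this

theorem mainTheorem3 : 3 ≤ maxToeplitzNumber 4 ∧ maxToeplitzNumber 4 ≤ 9 := by
  constructor
  · refine le_iSup_of_le (Matrix.diagonal fun i : Fin 4 ↦ ((i : ℕ) : ℂ)) (le_iInf₂ fun s hs ↦ ?_)
    by_contra! h
    have hs3 : s < 3 := by exact_mod_cast h
    exact not_hasToeplitzDecomposition_two (hs.mono (by omega))
  · exact iSup_le fun M ↦ iInf₂_le 9 (hasToeplitzDecomposition_nine M)
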